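/- Let $n\ge 0$, let $Y_1,\dots,Y_n$ be (almost surely) nonnegative, possibly dependent, real random variables on a common probability space, and let $X_1,\dots,X_n$ be negatively associated random variables (on a possibly different probability space) such that each $X_i$ has the same distribution as $Y_i$. Here $X_1,\dots,X_n$ are called negatively associated if for all disjoint $I,J\subseteq\{1,\dots,n\}$ and all coordinatewise nondecreasing Borel functions $f:\mathbb R^I\to\mathbb R$, $g:\mathbb R^J\to\mathbb R$, $$\mathbb E[f(X_i,i\in I)\,g(X_j,j\in J)]\le \mathbb E[f(X_i,i\in I)]\;\mathbb E[g(X_j,j\in J)]$$ whenever the three expectations exist and are finite. For random variables $U,V$, write $U\le_{cx}V$ if $\mathbb E\varphi(U)\le\mathbb E\varphi(V)$ for every convex $\varphi:\mathbb R\to\mathbb R$ for which both expectations exist in $[-\infty,\infty]$. Then: 1. If $P$ is a Poisson random variable with parameter $1$, defined on the probability space of $(Y_1,\dots,Y_n)$ and independent of the vector $(Y_1,\dots,Y_n)$, then $$\sum_{i=1}^n X_i\;\le_{cx}\;P\sum_{i=1}^n Y_i .$$ 2. For every convex nonnegative function $f$ on $[0,\infty)$, $$\mathbb E\Big[f\Big(\sum_{i=1}^n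 X_i\Big)\Big]\le A(f)\;\mathbb E\Big[f\Big(\sum_{i=1}^n Y_i\Big)\Big]\quad\text{in }[0,\infty],\qquad A(f)=\sup_{t>0}\mathbb E\Big[\frac{f(tP)}{f(t)}\Big]\in[0,\infty],$$ where $P$ is Poisson with parameter $1$, with the conventions $0/0=0$ and $c/0=\infty$ for $c>0$, and provided that the right-hand side is not the indeterminate product $\infty\cdot 0$. 3. For every real $q\ge 1$, $$\Big\|\sum_{i=1}^n X_i\Big\|_q\le A_q^{1/q}\,\Big\|\sum_{i=1}^n Y_i\Big\|_q\quad\text{in }[0,\infty],$$ where $A_q=\mathbb E[P^q]=\sum_{t=1}^\infty t^q\,\frac{e^{-1}}{t!}$ is the $q$-th moment of a Poisson random variable $P$ with parameter $1$ (the fractional Bell number). -/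

import Mathlib

open MeasureTheory ProbabilityTheory
open scoped ENNReal

noncomputable section

/-- The expectation of `Z` exists (possibly as `+∞` or `-∞`): the positive part and the negative
part do not both have infinite expectation. -/
def ExpectationExists {Ω : Type*} [MeasurableSpace Ω] (μ : Measure Ω) (Z : Ω → ℝ) : Prop :=
  AEMeasurable Z μ ∧
    ((∫⁻ ω, ENNReal.ofReal (Z ω) ∂μ) ≠ ⊤ ∨ (∫⁻ ω, ENNReal.ofReal (-Z ω) ∂μ) ≠ ⊤)

/-- The expectation `E[Z⁺] - E[Z⁻]` in `[-∞, ∞]`, meaningful when `ExpectationExists μ Z`. -/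
def expectation {Ω : Type*} [MeasurableSpace Ω] (μ : Measure Ω) (Z : Ω → ℝ) : EReal :=
  ((∫⁻ ω, ENNReal.ofReal (Z ω) ∂μ : ℝ≥0∞) : EReal)
    - ((∫⁻ ω, ENNReal.ofReal (-Z ω) ∂μ : ℝ≥0∞) : EReal)

/-- The convex stochastic order: `E φ(U) ≤ E φ(V)` for every convex `φ : ℝ → ℝ` for which both
expectations exist. The variables may live on different probability spaces. -/
def ConvexOrderLE {Ω Ω' : Type*} [MeasurableSpace Ω] [MeasurableSpace Ω']
    (μ : Measure Ω) (U : Ω → ℝ) (ν : Measure Ω') (V : Ω' → ℝ) : Prop :=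
  ∀ φ : ℝ → ℝ, ConvexOn ℝ Set.univ φ →
    ExpectationExists μ (fun ω => φ (U ω)) → ExpectationExists ν (fun ω => φ (V ω)) →
      expectation μ (fun ω => φ (U ω)) ≤ expectation ν (fun ω => φ (V ω))

/-- Negative association: for disjoint sets `I`, `J` of indices and functions `f : ℝ^I → ℝ` and
`g : ℝ^J → ℝ` that are nondecreasing for the coordinatewise order,
`E[f(X_I) g(X_J)] ≤ E[f(X_I)] E[g(X_J)]` whenever these expectations exist. -/
def NegativelyAssociated {Ω : Type*} [MeasurableSpace Ω] (μ : Measure Ω) {n : ℕ}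
    (X : Fin n → Ω → ℝ) : Prop :=
  ∀ (I J : Finset (Fin n)), Disjoint I J →
    ∀ (f : (I → ℝ) → ℝ) (g : (J → ℝ) → ℝ), Monotone f → Monotone g →
      Measurable f → Measurable g →
      Integrable (fun ω => f (fun i => X i ω)) μ →
      Integrable (fun ω => g (fun j => X j ω)) μ →
      Integrable (fun ω => f (fun i => X i ω) * g (fun j => X j ω)) μ →
        ∫ ω, f (fun i => X i ω) * g (fun j => X j ω) ∂μ
          ≤ (∫ ω, f (fun i => X i ω) ∂μ) * ∫ ω, g (fun j => X j ω) ∂μ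

/-- `A(f) = sup_{t > 0} E[f(tP) / f(t)]` in `[0, ∞]`, where `P` is Poisson with parameter `1` and
`f` is nonnegative on `[0, ∞)`. In `[0, ∞]`, `0 / 0 = 0` and `c / 0 = ∞` for `c > 0`. -/
def poissonRatio (f : ℝ → ℝ) : ℝ≥0∞ :=
  ⨆ (t : ℝ) (_ : 0 < t),
    ∫⁻ k : ℕ, ENNReal.ofReal (f (t * (k : ℝ))) / ENNReal.ofReal (f t) ∂(poissonMeasure 1)

/-- The fractional Bell number `A_q`: the `q`-th moment of a Poisson variable with parameter `1`. -/
def fractionalBell (q : ℝ) : ℝ :=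
  ∫ k : ℕ, (k : ℝ) ^ q ∂(poissonMeasure 1)

end

/-! Everything follows from one estimate, `NegativelyAssociated.lintegral_sum_le_poisson`: for
convex `f ≥ 0` on the half-line, `E f(∑ X i) ≤ E f(P * S)`, where `S = ∑ Y i` and `P` is an
independent Poisson variable. The bridge is a family of independent `Z i` with the marginals of the
`Y i`.

From `X` to `Z`: by convexity, the increments of `b ↦ f (a + b)` are nondecreasing in `a`, so
negative association decouples one summand at a time
(`NegativelyAssociated.lintegral_sum_le_of_iIndepFun`). This is done for variables on a finite grid,
and the general case is a limit of roundings from below.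

From `Z` to `P * S`: take `m` independent copies of the vector `Y` and read `Y i` off copy `σ i`. An
injective `σ` yields the law of `Z`, and a uniform `σ` is injective with probability tending to 1.
Averaged over all `σ`, the value of `f` is at most its mean at `∑ k ∈ B, S k`, where `S k` is the
total of copy `k` and `B` keeps each copy with probability `1 / m` (`ConvexOn.sum_allocation_le`).
Jensen replaces this sum by `B.card * S`, and the binomial law of `B.card` is dominated by `m / (m -
1)` times the Poisson law (`choose_mul_pow_le_poisson`). Let `m → ∞`.

For the convex order, `φ` is truncated below and shifted to be nonnegative; for the bound by `A(f)`,
one integrates over `P` first with `S` fixed; for moments, `(P * S) ^ q` factors. -/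

/-! ### Increments of convex functions on the half-line -/

/-- The two inner points are convex combinations of the two outer ones with swapped weights; add the
two convexity inequalities. -/
theorem ConvexOn.add_map_le_map_add {f : ℝ → ℝ} (hf : ConvexOn ℝ (Set.Ici 0) f) {a b c : ℝ}
    (ha : 0 ≤ a) (hb : 0 ≤ b) (hc : 0 ≤ c) :
    f (a + b) + f (a + c) ≤ f a + f (a + b + c) := by
  rcases (add_nonneg hb hc).eq_or_lt with h | h
  · obtain rfl : b = 0 := by linarith
    obtain rfl : c = 0 := by linarith
    simp
  have hA : a ∈ Set.Ici (0 : ℝ) := ha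
  have hE : a + b + c ∈ Set.Ici (0 : ℝ) := by simp only [Set.mem_Ici]; positivity
  have hb' : 0 ≤ b / (b + c) := by positivity
  have hc' : 0 ≤ c / (b + c) := by positivity
  have h1 := hf.2 hA hE hc' hb' (by field_simp; ring)
  have h2 := hf.2 hA hE hb' hc' (by field_simp)
  simp only [smul_eq_mul] at h1 h2
  rw [show c / (b + c) * a + b / (b + c) * (a + b + c) = a + b by field_simp; ring] at h1
  rw [show b / (b + c) * a + c / (b + c) * (a + b + c) = a + c by field_simp; ring] at h2
  have h3 : c / (b + c) = 1 - b / (b + c) := by field_simp; ring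
  rw [h3] at h1 h2
  linarith

theorem ConvexOn.sum_increments_le {ι : Type*} {f : ℝ → ℝ} (hf : ConvexOn ℝ (Set.Ici 0) f)
    (y : ι → ℝ) (hy : ∀ k, 0 ≤ y k) (B : Finset ι) {a : ℝ} (ha : 0 ≤ a) :
    f a + ∑ k ∈ B, (f (a + y k) - f a) ≤ f (a + ∑ k ∈ B, y k) := by
  classical
  induction B using Finset.induction_on with
  | empty => simp
  | insert k B hk ih =>
    rw [Finset.sum_insert hk, Finset.sum_insert hk]
    have := hf.add_map_le_map_add ha (Finset.sum_nonneg fun i (_ : i ∈ B) => hy i) (hy k)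
    rw [show a + (y k + ∑ x ∈ B, y x) = a + ∑ x ∈ B, y x + y k by ring]
    linarith [ih]

/-! ### Random subsets and the allocation inequality -/

/-- The expectation of `F B`, where `B` is a random subset of `s` that contains each element
independently with probability `p`. -/
def randomSubsetMean {ι : Type*} (p : ℝ) (s : Finset ι) (F : Finset ι → ℝ) : ℝ :=
  ∑ B ∈ s.powerset, p ^ B.card * (1 - p) ^ (s.card - B.card) * F B

theorem randomSubsetMean_mono {ι : Type*} {p : ℝ} (hp : 0 ≤ p) (hp1 : p ≤ 1) (s : Finset ι)
    {F G : Finset ι → ℝ} (h : ∀ B, F B ≤ G B) :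
    randomSubsetMean p s F ≤ randomSubsetMean p s G :=
  Finset.sum_le_sum fun B _ => mul_le_mul_of_nonneg_left (h B)
    (mul_nonneg (pow_nonneg hp _) (pow_nonneg (sub_nonneg.2 hp1) _))

theorem randomSubsetMean_add {ι : Type*} (p : ℝ) (s : Finset ι) (F G : Finset ι → ℝ) :
    randomSubsetMean p s (fun B => F B + G B) = randomSubsetMean p s F + randomSubsetMean p s G := by
  simp [randomSubsetMean, mul_add, Finset.sum_add_distrib]

theorem randomSubsetMean_sub {ι : Type*} (p : ℝ) (s : Finset ι) (F G : Finset ι → ℝ) :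
    randomSubsetMean p s (fun B => F B - G B) = randomSubsetMean p s F - randomSubsetMean p s G := by
  simp [randomSubsetMean, mul_sub, Finset.sum_sub_distrib]

theorem randomSubsetMean_sum {ι κ : Type*} (p : ℝ) (s : Finset ι) (t : Finset κ)
    (F : κ → Finset ι → ℝ) :
    randomSubsetMean p s (fun B => ∑ k ∈ t, F k B) = ∑ k ∈ t, randomSubsetMean p s (F k) := by
  simp only [randomSubsetMean, Finset.mul_sum]
  exact Finset.sum_comm

theorem randomSubsetMean_insert {ι : Type*} [DecidableEq ι] (p : ℝ) {s : Finset ι} {k : ι}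
    (hk : k ∉ s) (F : Finset ι → ℝ) :
    randomSubsetMean p (insert k s) F =
      (1 - p) * randomSubsetMean p s F + p * randomSubsetMean p s (fun B => F (insert k B)) := by
  rw [randomSubsetMean, Finset.sum_powerset_insert hk, randomSubsetMean, randomSubsetMean,
    Finset.mul_sum, Finset.mul_sum]
  congr 1 <;> refine Finset.sum_congr rfl fun B hB => ?_
  · have := Finset.card_le_card (Finset.mem_powerset.1 hB)
    rw [Finset.card_insert_of_notMem hk, Nat.succ_sub this, pow_succ]
    ring
  · rw [Finset.card_insert_of_notMem hk,
      Finset.card_insert_of_notMem fun h => hk (Finset.mem_powerset.1 hB h), Nat.add_sub_add_right,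
      pow_succ]
    ring

/-- Conditioning on `k ∈ B` can only raise the mean of `G`. Splitting off the element `k` makes both
sides means over subsets of `s.erase k`. -/
theorem mul_randomSubsetMean_le {ι : Type*} [DecidableEq ι] {p : ℝ} (hp : 0 ≤ p) (hp1 : p ≤ 1)
    {s : Finset ι} {k : ι} (hk : k ∈ s) {G : Finset ι → ℝ} (hG : ∀ B, G B ≤ G (insert k B)) :
    p * randomSubsetMean p s G ≤ randomSubsetMean p s (fun B => if k ∈ B then G B else 0) := by
  rw [← Finset.insert_erase hk, randomSubsetMean_insert p (Finset.notMem_erase k s),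
    randomSubsetMean_insert p (Finset.notMem_erase k s)]
  have h0 : randomSubsetMean p (s.erase k) (fun B => if k ∈ B then G B else 0) = 0 := by
    refine Finset.sum_eq_zero fun B hB => ?_
    simp only []
    rw [if_neg fun h => Finset.notMem_erase k s (Finset.mem_powerset.1 hB h), mul_zero]
  have h1 := randomSubsetMean_mono hp hp1 (s.erase k) hG
  simp only [Finset.mem_insert_self, if_true, h0, mul_zero, zero_add]
  nlinarith [mul_le_mul_of_nonneg_left h1 (sub_nonneg.2 hp1)]

/-- A jump `y k` at a uniform index `k` is traded for the jumps at all `k ∈ B`; since `p * t.card =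
1`, the mean total is unchanged. The increment of `f` caused by `y k` grows with `B`, so it
correlates positively with `k ∈ B`, and the increments over `k ∈ B` sum to at most the joint
increment. -/
theorem ConvexOn.sum_randomSubsetMean_le {ι : Type*} [DecidableEq ι] {f : ℝ → ℝ}
    (hf : ConvexOn ℝ (Set.Ici 0) f) {p : ℝ} (hp : 0 ≤ p) (hp1 : p ≤ 1) (t : Finset ι)
    (ht : p * t.card = 1) (s y : ι → ℝ) (hs : ∀ k, 0 ≤ s k) (hy : ∀ k, 0 ≤ y k) :
    p * ∑ k ∈ t, randomSubsetMean p t (fun B => f (∑ i ∈ B, s i + y k)) ≤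
      randomSubsetMean p t (fun B => f (∑ i ∈ B, (s i + y i))) := by
  have hS (B : Finset ι) : 0 ≤ ∑ i ∈ B, s i := Finset.sum_nonneg fun i _ => hs i
  have key (k) (hk : k ∈ t) := mul_randomSubsetMean_le hp hp1 hk
    (G := fun B => f (∑ i ∈ B, s i + y k) - f (∑ i ∈ B, s i)) (by
      intro B
      by_cases h : k ∈ B
      · rw [Finset.insert_eq_of_mem h]
      · rw [Finset.sum_insert h]
        have := hf.add_map_le_map_add (hS B) (hs k) (hy k)
        rw [add_comm (s k)]
        linarith)
  have h1 : randomSubsetMean p t (fun B => f (∑ i ∈ B, s i)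
      + ∑ k ∈ t, if k ∈ B then f (∑ i ∈ B, s i + y k) - f (∑ i ∈ B, s i) else 0) ≤
      randomSubsetMean p t (fun B => f (∑ i ∈ B, (s i + y i))) := by
    refine Finset.sum_le_sum fun B hB => mul_le_mul_of_nonneg_left ?_
      (mul_nonneg (pow_nonneg hp _) (pow_nonneg (sub_nonneg.2 hp1) _))
    simp only []
    rw [Finset.sum_add_distrib, Finset.sum_ite_mem,
      Finset.inter_eq_right.2 (Finset.mem_powerset.1 hB)]
    exact hf.sum_increments_le y hy B (hS B)
  refine le_trans ?_ h1
  rw [randomSubsetMean_add, randomSubsetMean_sum]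
  have h2 := Finset.sum_le_sum key
  simp only [randomSubsetMean_sub, mul_sub, Finset.sum_sub_distrib, Finset.sum_const,
    nsmul_eq_mul, ← Finset.mul_sum] at h2
  -- Cancels the base terms: `t.card` copies of the mean of `f (∑ i ∈ B, s i)`, weighted by `p`,
  -- make exactly one.
  have h3 := congrArg (· * randomSubsetMean p t (fun B => f (∑ i ∈ B, s i))) ht
  simp only [one_mul] at h3
  nlinarith

theorem ConvexOn.comp_add_right_Ici {f : ℝ → ℝ} (hf : ConvexOn ℝ (Set.Ici 0) f) {b : ℝ}
    (hb : 0 ≤ b) : ConvexOn ℝ (Set.Ici 0) (fun x => f (x + b)) :=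
  (hf.translate_left b).subset (fun x hx => by
    simp only [Set.mem_Ici, Set.mem_preimage] at *
    positivity) (convex_Ici 0)

theorem ConvexOn.sum_allocation_le {f : ℝ → ℝ}
    (hf : ConvexOn ℝ (Set.Ici 0) f) {m : ℕ} (hm : 0 < m) (n : ℕ) (y : Fin n → Fin m → ℝ)
    (hy : ∀ i k, 0 ≤ y i k) :
    ((m : ℝ)⁻¹) ^ n * ∑ σ : Fin n → Fin m, f (∑ i, y i (σ i)) ≤
      randomSubsetMean (m : ℝ)⁻¹ Finset.univ (fun B => f (∑ k ∈ B, ∑ i, y i k)) := by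
  have hp1 : (m : ℝ)⁻¹ ≤ 1 := inv_le_one_of_one_le₀ (by exact_mod_cast hm)
  have hp : 0 ≤ (m : ℝ)⁻¹ := by positivity
  have hm' : (m : ℝ) ≠ 0 := by positivity
  induction n generalizing f with
  | zero =>
    simp only [pow_zero, one_mul, Finset.univ_eq_empty, Finset.sum_empty, Finset.sum_const_zero,
      Finset.sum_const, randomSubsetMean, ← Finset.sum_mul]
    have := Finset.sum_pow_mul_eq_add_pow (m : ℝ)⁻¹ (1 - (m : ℝ)⁻¹) (Finset.univ : Finset (Fin m))
    rw [this]
    simp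
  | succ n ih =>
    have h := hf.sum_randomSubsetMean_le hp hp1 (Finset.univ : Finset (Fin m))
      (by simp [hm']) (fun k => ∑ i : Fin n, y i.castSucc k) (fun k => y (Fin.last n) k)
      (fun k => Finset.sum_nonneg fun i _ => hy _ _) (fun k => hy _ _)
    simp only [Fin.sum_univ_castSucc (n := n)]
    refine le_trans ?_ h
    -- Fix the value `k` of `σ` at the last index; the other indices are handled by the induction
    -- hypothesis for `f` shifted by `y (Fin.last n) k`.
    rw [← (Fin.snocEquiv (fun _ : Fin (n + 1) => Fin m)).sum_comp, Fintype.sum_prod_type,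
      pow_succ', mul_assoc, Finset.mul_sum]
    refine mul_le_mul_of_nonneg_left (Finset.sum_le_sum fun k _ => ?_) hp
    have hfk : ConvexOn ℝ (Set.Ici 0) (fun x => f (x + y (Fin.last n) k)) :=
      hf.comp_add_right_Ici (hy _ _)
    simpa [Fin.snocEquiv] using ih hfk (fun i k => y i.castSucc k) (fun i k => hy _ _)

/-! ### Binomial weights against Poisson weights -/

theorem descFactorial_mul_le (m b : ℕ) : m.descFactorial b * (m - 1) ≤ m * (m - 1) ^ b := by
  induction b with
  | zero => simp
  | succ b ih =>
    rcases Nat.eq_zero_or_pos b with rfl | hb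
    · simp
    · rw [Nat.descFactorial_succ, pow_succ, ← mul_assoc, mul_assoc, mul_comm]
      exact Nat.mul_le_mul ih (by omega)

/-- All factors of the falling factorial after the first are at most `m - 1`, which turns the weight
into a multiple of `(1 - 1/m) ^ m ≤ exp (-1)`. A one-sided bound suffices, as the factor `m / (m -
1)` tends to 1 uniformly in `b`; no convergence of laws is needed. -/
theorem choose_mul_pow_le_poisson {m : ℕ} (hm : 2 ≤ m) {b : ℕ} (hb : b ≤ m) :
    (m.choose b : ℝ) * ((m : ℝ)⁻¹ ^ b * (1 - (m : ℝ)⁻¹) ^ (m - b)) ≤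
      m / (m - 1) * (Real.exp (-1) / b.factorial) := by
  have hm' : (2 : ℝ) ≤ m := by exact_mod_cast hm
  have h1 : (0 : ℝ) < m - 1 := by linarith
  have h0 : (0 : ℝ) < m := by linarith
  have hd : (m.descFactorial b : ℝ) * (m - 1) ≤ m * (m - 1) ^ b := by
    have := descFactorial_mul_le m b
    rw [← Nat.cast_le (α := ℝ)] at this
    push_cast [Nat.cast_sub (show 1 ≤ m by omega)] at this
    exact this
  have hp : 1 - (m : ℝ)⁻¹ = (m - 1) / m := by field_simp
  have he : (1 - (m : ℝ)⁻¹) ^ m ≤ Real.exp (-1) := by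
    have h2 : 1 - (m : ℝ)⁻¹ ≤ Real.exp (-(m : ℝ)⁻¹) := by
      have := Real.add_one_le_exp (-(m : ℝ)⁻¹); linarith
    calc _ ≤ Real.exp (-(m : ℝ)⁻¹) ^ m :=
          pow_le_pow_left₀ (by rw [hp]; positivity) h2 m
      _ = _ := by rw [← Real.exp_nat_mul]; congr 1; field_simp
  have hfac : (m.choose b : ℝ) = m.descFactorial b / b.factorial := by
    rw [eq_div_iff (by positivity), mul_comm, ← Nat.cast_mul, ← Nat.descFactorial_eq_factorial_mul_choose]
  have hc : (m.descFactorial b : ℝ) ≤ m / (m - 1) * (m - 1) ^ b := by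
    rw [div_mul_eq_mul_div, le_div_iff₀ h1]; exact hd
  rw [hfac]
  calc _ = (m.descFactorial b : ℝ) * (((m : ℝ)⁻¹) ^ b * (1 - (m : ℝ)⁻¹) ^ (m - b)) / b.factorial := by
        ring
    _ ≤ (m / (m - 1) * (m - 1) ^ b) * (((m : ℝ)⁻¹) ^ b * (1 - (m : ℝ)⁻¹) ^ (m - b))
          / b.factorial := by
        have : 0 ≤ 1 - (m : ℝ)⁻¹ := by rw [hp]; positivity
        gcongr
    _ = m / (m - 1) * (1 - (m : ℝ)⁻¹) ^ m / b.factorial := by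
        have e : ((m : ℝ) - 1) ^ b * (m : ℝ)⁻¹ ^ b = (1 - (m : ℝ)⁻¹) ^ b := by
          rw [← mul_pow, hp]; rfl
        rw [← Nat.add_sub_cancel' hb, pow_add, Nat.add_sub_cancel' hb, ← e]
        ring
    _ ≤ m / (m - 1) * Real.exp (-1) / b.factorial := by gcongr
    _ = _ := by ring

theorem tendsto_descFactorial_div_pow (n : ℕ) :
    Filter.Tendsto (fun m : ℕ => (m.descFactorial n : ℝ) / (m : ℝ) ^ n) Filter.atTop (nhds 1) := by
  induction n with
  | zero => simp
  | succ n ih =>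
    have h : Filter.Tendsto (fun m : ℕ => 1 - (n : ℝ) / m) Filter.atTop (nhds (1 - 0)) :=
      tendsto_const_nhds.sub (tendsto_const_div_atTop_nhds_zero_nat _)
    have h2 := h.mul ih
    simp only [sub_zero, mul_one] at h2
    refine h2.congr' ?_
    filter_upwards [Filter.eventually_ge_atTop (n + 1)] with m hm
    have : (m : ℝ) ≠ 0 := by have : 0 < m := by omega
                             positivity
    rw [Nat.descFactorial_succ, Nat.cast_mul, Nat.cast_sub (by omega)]
    field_simp
    ring

/-! ### From independent copies to a Poisson multiplier -/

section

variable {Ω' : Type*} [MeasurableSpace Ω'] {ν : Measure Ω'} [IsProbabilityMeasure ν]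

/-- Jensen: the sum is the average over `k ∈ B` of the points `B.card * S (ω k)`, all with the same
law. -/
theorem ConvexOn.lintegral_sum_copies_le {f : ℝ → ℝ} (hf : ConvexOn ℝ (Set.Ici 0) f)
    (hfm : Measurable f) (hf0 : ∀ x, 0 ≤ f x) {S : Ω' → ℝ} (hS : Measurable S)
    (hS0 : ∀ ω, 0 ≤ S ω) {m : ℕ} (B : Finset (Fin m)) :
    ∫⁻ ω, ENNReal.ofReal (f (∑ k ∈ B, S (ω k))) ∂(Measure.pi fun _ : Fin m => ν) ≤
      ∫⁻ ω, ENNReal.ofReal (f (B.card * S ω)) ∂ν := by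
  rcases B.eq_empty_or_nonempty with rfl | hB
  · simp
  have hc : (B.card : ℝ) ≠ 0 := by simpa using hB.ne_empty
  have key (ω : Fin m → Ω') : ENNReal.ofReal (f (∑ k ∈ B, S (ω k))) ≤
      ∑ k ∈ B, ENNReal.ofReal ((B.card : ℝ)⁻¹) * ENNReal.ofReal (f (B.card * S (ω k))) := by
    have h := hf.map_sum_le (t := B) (w := fun _ => (B.card : ℝ)⁻¹)
      (p := fun k => B.card * S (ω k)) (fun _ _ => by positivity) (by simp [hc])
      (fun k _ => mul_nonneg (Nat.cast_nonneg _) (hS0 _))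
    simp only [smul_eq_mul, inv_mul_cancel_left₀ hc] at h
    refine (ENNReal.ofReal_le_ofReal h).trans ?_
    rw [ENNReal.ofReal_sum_of_nonneg fun k _ => mul_nonneg (by positivity) (hf0 _)]
    exact (Finset.sum_congr rfl fun k _ => ENNReal.ofReal_mul (by positivity)).le
  have hmeas : Measurable fun ω => ENNReal.ofReal (f (B.card * S ω)) := by fun_prop
  refine (lintegral_mono key).trans ?_
  rw [lintegral_finsetSum _ fun k _ => by fun_prop]
  have e (k : Fin m) : ∫⁻ ω, ENNReal.ofReal ((B.card : ℝ)⁻¹) * ENNReal.ofReal (f (B.card * S (ω k)))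
      ∂(Measure.pi fun _ : Fin m => ν) =
      ENNReal.ofReal ((B.card : ℝ)⁻¹) * ∫⁻ ω, ENNReal.ofReal (f (B.card * S ω)) ∂ν := by
    rw [lintegral_const_mul _ (by fun_prop)]
    congr 1
    exact (measurePreserving_eval (fun _ : Fin m => ν) k).lintegral_comp hmeas
  rw [Finset.sum_congr rfl fun k _ => e k, Finset.sum_const, nsmul_eq_mul, ← mul_assoc,
    ← ENNReal.ofReal_natCast, ← ENNReal.ofReal_mul (by positivity), mul_inv_cancel₀ hc]
  simp

theorem ConvexOn.le_lintegral_poisson_of_le_copies {f : ℝ → ℝ} (hf : ConvexOn ℝ (Set.Ici 0) f)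
    (hfm : Measurable f) (hf0 : ∀ x, 0 ≤ f x) {n : ℕ} {Y : Fin n → Ω' → ℝ}
    (hY : ∀ i, Measurable (Y i)) (hY0 : ∀ i ω, 0 ≤ Y i ω) {a : ℝ≥0∞}
    (h : ∀ (m : ℕ) (σ : Fin n → Fin m), Function.Injective σ →
      a ≤ ∫⁻ ω, ENNReal.ofReal (f (∑ i, Y i (ω (σ i)))) ∂(Measure.pi fun _ : Fin m => ν)) :
    a ≤ ∫⁻ k : ℕ, ∫⁻ ω, ENNReal.ofReal (f (k * ∑ i, Y i ω)) ∂ν ∂(poissonMeasure 1) := by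
  classical
  set g : ℕ → ℝ≥0∞ := fun k => ∫⁻ ω, ENNReal.ofReal (f (k * ∑ i, Y i ω)) ∂ν with hg
  -- The loss consists of the proportion of injective maps `σ` and the inverse of the Poisson
  -- domination constant; both tend to 1.
  have hbound (m : ℕ) (hm : 2 ≤ m) :
      ENNReal.ofReal (m.descFactorial n / (m : ℝ) ^ n * ((m - 1) / m)) * a ≤
        ∫⁻ k, g k ∂(poissonMeasure 1) := by
    have hm' : (2 : ℝ) ≤ m := by exact_mod_cast hm
    have h1 : (0 : ℝ) < m - 1 := by linarith
    have h0 : (0 : ℝ) < m := by linarith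
    have hp1 : 0 ≤ 1 - (m : ℝ)⁻¹ := sub_nonneg.2 (inv_le_one_of_one_le₀ (by linarith))
    set π := Measure.pi fun _ : Fin m => ν
    have s1 : (m.descFactorial n : ℝ≥0∞) * a ≤
        ∑ σ : Fin n → Fin m, ∫⁻ ω, ENNReal.ofReal (f (∑ i, Y i (ω (σ i)))) ∂π := by
      have hcard : Fintype.card (Fin n ↪ Fin m) = m.descFactorial n := by
        rw [Fintype.card_embedding_eq]; simp
      calc (m.descFactorial n : ℝ≥0∞) * a = ∑ _σ : Fin n ↪ Fin m, a := by
            rw [Finset.sum_const, Finset.card_univ, hcard, nsmul_eq_mul]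
        _ ≤ ∑ σ : Fin n ↪ Fin m, ∫⁻ ω, ENNReal.ofReal (f (∑ i, Y i (ω (σ i)))) ∂π :=
            Finset.sum_le_sum fun σ _ => h m σ σ.injective
        _ = ∑ σ ∈ Finset.univ.map ⟨fun σ : Fin n ↪ Fin m => (σ : Fin n → Fin m),
              DFunLike.coe_injective⟩, ∫⁻ ω, ENNReal.ofReal (f (∑ i, Y i (ω (σ i)))) ∂π := by
            rw [Finset.sum_map]; rfl
        -- Non-injective `σ` contribute nonnegative terms, so they may be added for free.
        _ ≤ _ := Finset.sum_le_sum_of_subset (Finset.subset_univ _)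
    have s2 (ω : Fin m → Ω') : ∑ σ : Fin n → Fin m, ENNReal.ofReal (f (∑ i, Y i (ω (σ i)))) ≤
        ENNReal.ofReal ((m : ℝ) ^ n) * ∑ B ∈ (Finset.univ : Finset (Fin m)).powerset,
          ENNReal.ofReal ((m : ℝ)⁻¹ ^ B.card * (1 - (m : ℝ)⁻¹) ^ (m - B.card)) *
            ENNReal.ofReal (f (∑ k ∈ B, ∑ i, Y i (ω k))) := by
      have hd := hf.sum_allocation_le (by omega : 0 < m) n (fun i k => Y i (ω k))
        (fun i k => hY0 _ _)
      rw [inv_pow, inv_mul_le_iff₀ (by positivity)] at hd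
      rw [← ENNReal.ofReal_sum_of_nonneg fun _ _ => hf0 _]
      refine (ENNReal.ofReal_le_ofReal hd).trans ?_
      rw [ENNReal.ofReal_mul (by positivity), randomSubsetMean,
        ENNReal.ofReal_sum_of_nonneg fun B _ => mul_nonneg (by positivity) (hf0 _)]
      simp only [Finset.card_univ, Fintype.card_fin]
      gcongr with B
      rw [ENNReal.ofReal_mul (by positivity)]
    have s3 : (m.descFactorial n : ℝ≥0∞) * a ≤ ENNReal.ofReal ((m : ℝ) ^ n) *
        ∑ B ∈ (Finset.univ : Finset (Fin m)).powerset,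
          ENNReal.ofReal ((m : ℝ)⁻¹ ^ B.card * (1 - (m : ℝ)⁻¹) ^ (m - B.card)) * g B.card := by
      refine s1.trans ?_
      rw [← lintegral_finsetSum _ fun σ _ => by fun_prop]
      refine (lintegral_mono s2).trans ?_
      rw [lintegral_const_mul _ (by fun_prop), lintegral_finsetSum _ fun B _ => by fun_prop]
      gcongr with B
      rw [lintegral_const_mul _ (by fun_prop)]
      gcongr
      exact hf.lintegral_sum_copies_le hfm hf0 (by fun_prop)
        (fun ω => Finset.sum_nonneg fun i _ => hY0 i ω) B
    have s4 : ∑ B ∈ (Finset.univ : Finset (Fin m)).powerset,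
          ENNReal.ofReal ((m : ℝ)⁻¹ ^ B.card * (1 - (m : ℝ)⁻¹) ^ (m - B.card)) * g B.card ≤
        ENNReal.ofReal (m / (m - 1)) * ∫⁻ k, g k ∂(poissonMeasure 1) := by
      rw [Finset.sum_powerset_apply_card
        (fun b => ENNReal.ofReal ((m : ℝ)⁻¹ ^ b * (1 - (m : ℝ)⁻¹) ^ (m - b)) * g b),
        Finset.card_univ, Fintype.card_fin, lintegral_countable', ← ENNReal.tsum_mul_left]
      refine le_trans (Finset.sum_le_sum fun b hb => ?_)
        (ENNReal.sum_le_tsum (Finset.range (m + 1)))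
      rw [poissonMeasure_singleton, nsmul_eq_mul, ← mul_assoc, mul_left_comm _ (g b), mul_comm (g b)]
      refine mul_le_mul_left ?_ _
      rw [← ENNReal.ofReal_natCast, ← ENNReal.ofReal_mul (by positivity),
        ← ENNReal.ofReal_mul (by positivity)]
      refine ENNReal.ofReal_le_ofReal ?_
      simpa using choose_mul_pow_le_poisson hm (Nat.lt_succ_iff.1 (Finset.mem_range.1 hb))
    have s5 := s3.trans (mul_le_mul_right s4 _)
    rw [← ENNReal.ofReal_natCast, ← mul_assoc, ← ENNReal.ofReal_mul (by positivity)] at s5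
    have s6 := mul_le_mul_right s5 (ENNReal.ofReal (1 / (m : ℝ) ^ n * ((m - 1) / m)))
    rw [← mul_assoc, ← mul_assoc, ← ENNReal.ofReal_mul (by positivity),
      ← ENNReal.ofReal_mul (by positivity)] at s6
    rw [show (1 / (m : ℝ) ^ n * ((m - 1) / m)) * ((m : ℝ) ^ n * (m / (m - 1))) = 1 by field_simp,
      ENNReal.ofReal_one, one_mul] at s6
    rwa [show (m.descFactorial n : ℝ) / (m : ℝ) ^ n * ((m - 1) / m) =
      1 / (m : ℝ) ^ n * ((m - 1) / m) * m.descFactorial n by ring]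
  have hlim : Filter.Tendsto (fun m : ℕ =>
      ENNReal.ofReal (m.descFactorial n / (m : ℝ) ^ n * ((m - 1) / m)) * a) Filter.atTop
      (nhds a) := by
    have h1 : Filter.Tendsto (fun m : ℕ => ((m : ℝ) - 1) / m) Filter.atTop (nhds (1 - 0)) := by
      have : Filter.Tendsto (fun m : ℕ => 1 - (1 : ℝ) / m) Filter.atTop (nhds (1 - 0)) :=
        tendsto_const_nhds.sub (tendsto_const_div_atTop_nhds_zero_nat _)
      refine this.congr' ?_
      filter_upwards [Filter.eventually_gt_atTop 0] with m hm
      have : (m : ℝ) ≠ 0 := by positivity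
      field_simp
    have h2 := ENNReal.tendsto_ofReal ((tendsto_descFactorial_div_pow n).mul h1)
    simp only [sub_zero, mul_one, ENNReal.ofReal_one] at h2
    simpa using ENNReal.Tendsto.mul_const (b := a) h2 (Or.inl one_ne_zero)
  exact le_of_tendsto hlim (Filter.eventually_atTop.2 ⟨2, hbound⟩)

end

/-! ### From negative association to independence, on a grid -/

theorem ConvexOn.map_le_add_of_nonneg {f : ℝ → ℝ} (hf : ConvexOn ℝ (Set.Ici 0) f)
    (hf0 : ∀ x, 0 ≤ f x) {x y : ℝ} (hx : 0 ≤ x) (hxy : x ≤ y) : f x ≤ f 0 + f y := by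
  refine (hf.le_max_of_mem_Icc (x := 0) (y := y) Set.self_mem_Ici (hx.trans hxy) ⟨hx, hxy⟩).trans ?_
  exact max_le (le_add_of_nonneg_right (hf0 _)) (le_add_of_nonneg_left (hf0 _))

/-- Telescoping along the grid writes `f (a + b)` as a finite sum of products of a function of `a`
and an indicator of `b`, the form to which negative association applies. -/
theorem map_add_grid (f : ℝ → ℝ) {δ : ℝ} (hδ : 0 < δ) {N c : ℕ} (hc : c ≤ N) (a : ℝ) :
    f (a + δ * c) = f a + ∑ j ∈ Finset.range N,
      (f (a + δ * (j + 1)) - f (a + δ * j)) * (if δ * j < δ * c then 1 else 0) := by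
  have h := Finset.sum_range_sub (fun j : ℕ => f (a + δ * j)) c
  have h2 : ∑ j ∈ Finset.range N,
      (f (a + δ * (j + 1)) - f (a + δ * j)) * (if δ * j < δ * c then 1 else 0) =
      ∑ j ∈ Finset.range c, (f (a + δ * (j + 1)) - f (a + δ * j)) := by
    simp only [mul_ite, mul_one, mul_zero, ← Finset.sum_filter]
    refine Finset.sum_congr ?_ fun _ _ => rfl
    ext j
    simp only [Finset.mem_filter, Finset.mem_range, mul_lt_mul_iff_right₀ hδ, Nat.cast_lt]
    omega
  rw [h2]
  push_cast at h
  rw [h]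
  simp

theorem NegativelyAssociated.comp_monotone {Ω : Type*} [MeasurableSpace Ω]
    {μ : Measure Ω} {n : ℕ} {X : Fin n → Ω → ℝ}
    (h : NegativelyAssociated μ X) {r : ℝ → ℝ} (hr : Monotone r) :
    NegativelyAssociated μ (fun i ω => r (X i ω)) :=
  fun I J hIJ f g hf hg hfm hgm hfi hgi hfgi =>
    h I J hIJ (fun x => f fun i => r (x i)) (fun x => g fun i => r (x i))
      (fun _ _ hxy => hf fun i => hr (hxy i)) (fun _ _ hxy => hg fun i => hr (hxy i))
      (hfm.comp (measurable_pi_lambda _ fun i => hr.measurable.comp (measurable_pi_apply i)))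
      (hgm.comp (measurable_pi_lambda _ fun i => hr.measurable.comp (measurable_pi_apply i)))
      hfi hgi hfgi

section

variable {Ω : Type*} [MeasurableSpace Ω] {μ : Measure Ω} [IsProbabilityMeasure μ]

/-- The right side replaces `B` by an independent copy. In the grid expansion the coefficient
functions of `A` are monotone by convexity, so `hAB` applies term by term; boundedness makes every
term integrable. -/
theorem ConvexOn.lintegral_add_le_lintegral_lintegral {f : ℝ → ℝ}
    (hf : ConvexOn ℝ (Set.Ici 0) f) (hfm : Measurable f) (hf0 : ∀ x, 0 ≤ f x) {A B : Ω → ℝ}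
    (hA : AEMeasurable A μ) (hB : AEMeasurable B μ) {M : ℝ} (hA0 : ∀ ω, 0 ≤ A ω)
    (hAM : ∀ ω, A ω ≤ M) {δ : ℝ} (hδ : 0 < δ) {N : ℕ} (hBN : ∀ ω, ∃ c : ℕ, c ≤ N ∧ B ω = δ * c)
    (hAB : ∀ (F : ℝ → ℝ) (t : ℝ), Monotone F → Integrable (fun ω => F (A ω)) μ →
      ∫ ω, F (A ω) * (if t < B ω then 1 else 0) ∂μ ≤
        (∫ ω, F (A ω) ∂μ) * ∫ ω, (if t < B ω then 1 else 0) ∂μ) :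
    ∫⁻ ω, ENNReal.ofReal (f (A ω + B ω)) ∂μ ≤
      ∫⁻ ω', ∫⁻ ω, ENNReal.ofReal (f (A ω + B ω')) ∂μ ∂μ := by
  -- The cut-off `max a 0` makes `F j` monotone on all of `ℝ`, although `f` is convex only on the
  -- half-line.
  set F : ℕ → ℝ → ℝ := fun j a => f (max a 0 + δ * (j + 1)) - f (max a 0 + δ * j) with hF
  have hFA (j : ℕ) (ω : Ω) : F j (A ω) = f (A ω + δ * (j + 1)) - f (A ω + δ * j) := by
    simp only [hF, max_eq_left (hA0 ω)]
  have hFmono (j : ℕ) : Monotone (F j) := by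
    intro a b hab
    have h1 : max a 0 ≤ max b 0 := max_le_max_right 0 hab
    have := hf.add_map_le_map_add (a := max a 0 + δ * j) (b := δ) (c := max b 0 - max a 0)
      (by positivity) hδ.le (sub_nonneg.2 h1)
    simp only [hF]
    rw [show max a 0 + δ * j + δ = max a 0 + δ * (j + 1) by ring,
      show max a 0 + δ * j + (max b 0 - max a 0) = max b 0 + δ * j by ring,
      show max a 0 + δ * (j + 1) + (max b 0 - max a 0) = max b 0 + δ * (j + 1) by ring] at this
    linarith
  have hfA (b : ℝ) (hb : 0 ≤ b) : Integrable (fun ω => f (A ω + b)) μ := by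
    refine Integrable.of_bound (by fun_prop : AEMeasurable _ μ).aestronglyMeasurable
      (f 0 + f (M + b)) (.of_forall fun ω => ?_)
    rw [Real.norm_of_nonneg (hf0 _)]
    exact hf.map_le_add_of_nonneg hf0 (add_nonneg (hA0 ω) hb) (by linarith [hAM ω])
  have hFi (j : ℕ) : Integrable (fun ω => F j (A ω)) μ := by
    simp only [hFA]
    exact (hfA _ (by positivity)).sub (hfA _ (by positivity))
  have hind (t : ℝ) : AEStronglyMeasurable (fun ω => if t < B ω then (1 : ℝ) else 0) μ :=
    ((Measurable.ite measurableSet_Ioi measurable_const measurable_const :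
      Measurable fun x : ℝ => if t < x then (1 : ℝ) else 0).comp_aemeasurable
        hB).aestronglyMeasurable
  have hindle (t : ℝ) (ω : Ω) : ‖(if t < B ω then (1 : ℝ) else 0)‖ ≤ 1 := by
    split_ifs <;> simp
  have hindi (t : ℝ) : Integrable (fun ω => if t < B ω then (1 : ℝ) else 0) μ :=
    Integrable.of_bound (hind t) 1 (.of_forall (hindle t))
  have hprod (j : ℕ) : Integrable (fun ω => F j (A ω) * (if δ * j < B ω then 1 else 0)) μ :=
    (hFi j).mul_bdd (hind _) (.of_forall (hindle _))
  have hA00 : Integrable (fun ω => f (A ω)) μ := by simpa using hfA 0 le_rfl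
  have hexp (ω ω' : Ω) : f (A ω + B ω') = f (A ω) + ∑ j ∈ Finset.range N,
      F j (A ω) * (if δ * j < B ω' then 1 else 0) := by
    obtain ⟨c, hc, hB'⟩ := hBN ω'
    simp only [hFA]
    rw [hB']
    exact map_add_grid f hδ hc _
  have hB0 (ω : Ω) : 0 ≤ B ω := by
    obtain ⟨c, -, hB'⟩ := hBN ω
    rw [hB']; positivity
  have hleft : ∫⁻ ω, ENNReal.ofReal (f (A ω + B ω)) ∂μ = ENNReal.ofReal
      ((∫ ω, f (A ω) ∂μ) +
        ∑ j ∈ Finset.range N, ∫ ω, F j (A ω) * (if δ * j < B ω then 1 else 0) ∂μ) := by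
    have hdiag : Integrable (fun ω => f (A ω + B ω)) μ := by
      simp only [hexp]
      exact hA00.add (integrable_finsetSum _ fun j _ => hprod j)
    rw [← ofReal_integral_eq_lintegral_ofReal hdiag (.of_forall fun ω => hf0 _)]
    simp only [hexp]
    rw [integral_add hA00 (integrable_finsetSum _ fun j _ => hprod j),
      integral_finsetSum _ fun j _ => hprod j]
  have hinner (ω' : Ω) : ∫⁻ ω, ENNReal.ofReal (f (A ω + B ω')) ∂μ = ENNReal.ofReal
      ((∫ ω, f (A ω) ∂μ) +
        ∑ j ∈ Finset.range N, (∫ ω, F j (A ω) ∂μ) * (if δ * j < B ω' then 1 else 0)) := by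
    rw [← ofReal_integral_eq_lintegral_ofReal (hfA _ (hB0 ω')) (.of_forall fun ω => hf0 _)]
    simp only [hexp _ ω']
    rw [integral_add hA00 (integrable_finsetSum _ fun j _ => (hFi j).mul_const _),
      integral_finsetSum _ fun j _ => (hFi j).mul_const _]
    simp only [integral_mul_const]
  have hpos (ω' : Ω) : 0 ≤ (∫ ω, f (A ω) ∂μ) +
      ∑ j ∈ Finset.range N, (∫ ω, F j (A ω) ∂μ) * (if δ * j < B ω' then 1 else 0) := by
    have : 0 ≤ ∫ ω, f (A ω + B ω') ∂μ := integral_nonneg fun _ => hf0 _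
    simp only [hexp _ ω'] at this
    rw [integral_add hA00 (integrable_finsetSum _ fun j _ => (hFi j).mul_const _),
      integral_finsetSum _ fun j _ => (hFi j).mul_const _] at this
    simpa only [integral_mul_const] using this
  have hi2 (j : ℕ) : Integrable
      (fun ω' => (∫ ω, F j (A ω) ∂μ) * (if δ * j < B ω' then (1 : ℝ) else 0)) μ :=
    (hindi _).const_mul _
  have hi3 : Integrable (fun ω' => (∫ ω, f (A ω) ∂μ) +
      ∑ j ∈ Finset.range N, (∫ ω, F j (A ω) ∂μ) * (if δ * j < B ω' then 1 else 0)) μ :=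
    (integrable_const _).add (integrable_finsetSum _ fun j _ => hi2 j)
  rw [hleft, lintegral_congr hinner, ← ofReal_integral_eq_lintegral_ofReal hi3 (.of_forall hpos)]
  refine ENNReal.ofReal_le_ofReal ?_
  rw [integral_add (integrable_const _) (integrable_finsetSum _ fun j _ => hi2 j),
    integral_finsetSum _ fun j _ => hi2 j, integral_const]
  simp only [integral_const_mul, probReal_univ, one_smul]
  gcongr with j
  exact hAB _ _ (hFmono j) (hFi j)

theorem NegativelyAssociated.integral_mul_indicator_le {n : ℕ} {X : Fin n → Ω → ℝ}
    (h : NegativelyAssociated μ X) (hX : ∀ i, AEMeasurable (X i) μ) {s : Finset (Fin n)}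
    {j : Fin n} (hj : j ∉ s) {F : ℝ → ℝ} (hF : Monotone F)
    (hFi : Integrable (fun ω => F (∑ i ∈ s, X i ω)) μ) (t : ℝ) :
    ∫ ω, F (∑ i ∈ s, X i ω) * (if t < X j ω then 1 else 0) ∂μ ≤
      (∫ ω, F (∑ i ∈ s, X i ω) ∂μ) * ∫ ω, (if t < X j ω then 1 else 0) ∂μ := by
  have hm : Measurable fun x : ℝ => if t < x then (1 : ℝ) else 0 :=
    Measurable.ite measurableSet_Ioi measurable_const measurable_const
  have hind : AEStronglyMeasurable (fun ω => if t < X j ω then (1 : ℝ) else 0) μ :=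
    (hm.comp_aemeasurable (hX j)).aestronglyMeasurable
  have hindle : ∀ᵐ ω ∂μ, ‖(if t < X j ω then (1 : ℝ) else 0)‖ ≤ 1 :=
    .of_forall fun ω => by split_ifs <;> simp
  have e (ω : Ω) : ∑ i : s, X i ω = ∑ i ∈ s, X i ω := Finset.sum_coe_sort s fun i => X i ω
  have := h s {j} (by simpa using hj) (fun x => F (∑ i, x i))
    (fun x => if t < x ⟨j, by simp⟩ then 1 else 0)
    (fun x y hxy => hF (Finset.sum_le_sum fun i _ => hxy i))
    (fun x y hxy => by
      dsimp only
      have := hxy ⟨j, by simp⟩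
      split_ifs with h1 h2
      · rfl
      · exact absurd (h1.trans_le this) h2
      · exact zero_le_one
      · rfl)
    (hF.measurable.comp (by fun_prop)) (hm.comp (measurable_pi_apply _))
    (by simpa only [e] using hFi) (Integrable.of_bound hind 1 hindle)
    (by simpa only [e] using hFi.mul_bdd hind hindle)
  simpa only [e] using this

/-- Induction on `s`: decouple `X j` from the rest, apply the hypothesis to `f` shifted by the
frozen value of `X j`, exchange `X j` for `Z j` by equality of laws, and reassemble by independence.
-/
theorem NegativelyAssociated.lintegral_sum_le_of_iIndepFun {Ω' : Type*} [MeasurableSpace Ω']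
    {π : Measure Ω'} [IsProbabilityMeasure π] {n : ℕ} {X : Fin n → Ω → ℝ} {Z : Fin n → Ω' → ℝ}
    (hNA : NegativelyAssociated μ X) (hZ : ∀ i, Measurable (Z i)) (hZi : iIndepFun Z π)
    (hXZ : ∀ i, IdentDistrib (X i) (Z i) μ π) {δ : ℝ} (hδ : 0 < δ) {N : ℕ}
    (hX : ∀ i ω, ∃ c : ℕ, c ≤ N ∧ X i ω = δ * c) (s : Finset (Fin n)) {f : ℝ → ℝ}
    (hf : ConvexOn ℝ (Set.Ici 0) f) (hfm : Measurable f) (hf0 : ∀ x, 0 ≤ f x) :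
    ∫⁻ ω, ENNReal.ofReal (f (∑ i ∈ s, X i ω)) ∂μ ≤
      ∫⁻ ω, ENNReal.ofReal (f (∑ i ∈ s, Z i ω)) ∂π := by
  have hXm (i) : AEMeasurable (X i) μ := (hXZ i).aemeasurable_fst
  have hX0 (i ω) : 0 ≤ X i ω := by
    obtain ⟨c, -, h⟩ := hX i ω
    rw [h]; positivity
  have hXN (i ω) : X i ω ≤ δ * N := by
    obtain ⟨c, hc, h⟩ := hX i ω
    rw [h]; gcongr
  induction s using Finset.induction_on generalizing f with
  | empty => simp
  | insert j s hj ih =>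
    set G : ℝ → ℝ≥0∞ := fun b => ∫⁻ ω, ENNReal.ofReal (f (∑ i ∈ s, Z i ω + b)) ∂π with hG
    have hGm : Measurable G := by
      refine Measurable.lintegral_prod_right'
        (f := fun z : ℝ × Ω' => ENNReal.ofReal (f (∑ i ∈ s, Z i z.2 + z.1))) ?_
      fun_prop
    calc ∫⁻ ω, ENNReal.ofReal (f (∑ i ∈ insert j s, X i ω)) ∂μ
        = ∫⁻ ω, ENNReal.ofReal (f (∑ i ∈ s, X i ω + X j ω)) ∂μ := by
          simp only [Finset.sum_insert hj, add_comm (X j _)]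
      _ ≤ ∫⁻ ω', ∫⁻ ω, ENNReal.ofReal (f (∑ i ∈ s, X i ω + X j ω')) ∂μ ∂μ :=
          hf.lintegral_add_le_lintegral_lintegral hfm hf0
            (Finset.aemeasurable_fun_sum _ fun i _ => hXm i) (hXm j)
            (fun ω => Finset.sum_nonneg fun i _ => hX0 i ω)
            (fun ω => Finset.sum_le_sum fun i _ => hXN i ω) hδ (hX j)
            (fun F t hF hFi => hNA.integral_mul_indicator_le hXm hj hF hFi t)
      _ ≤ ∫⁻ ω', G (X j ω') ∂μ :=
          lintegral_mono fun ω' => ih (f := fun x => f (x + X j ω'))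
            (hf.comp_add_right_Ici (hX0 j ω')) (by fun_prop) fun _ => hf0 _
      _ = ∫⁻ ω', G (Z j ω') ∂π := ((hXZ j).comp hGm).lintegral_eq
      _ = ∫⁻ ω, ENNReal.ofReal (f (∑ i ∈ s, Z i ω + Z j ω)) ∂π := by
          have hind : IndepFun (fun ω => ∑ i ∈ s, Z i ω) (Z j) π := by
            convert hZi.indepFun_finsetSum_of_notMem hZ hj using 1
            ext ω; simp
          have hS : Measurable fun ω => ∑ i ∈ s, Z i ω := by fun_prop
          have hfadd : Measurable fun z : ℝ × ℝ => ENNReal.ofReal (f (z.1 + z.2)) := by fun_prop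
          have h1 := lintegral_map hfadd (hS.prodMk (hZ j)) (μ := π)
          rw [← h1, (indepFun_iff_map_prod_eq_prod_map_map hS.aemeasurable (hZ j).aemeasurable).1
            hind, lintegral_prod_symm _ hfadd.aemeasurable,
            lintegral_map hfadd.lintegral_prod_left' (hZ j)]
          refine lintegral_congr fun ω' => ?_
          rw [lintegral_map (by fun_prop) hS]
      _ = ∫⁻ ω, ENNReal.ofReal (f (∑ i ∈ insert j s, Z i ω)) ∂π := by
          simp only [Finset.sum_insert hj, add_comm (Z j _)]

end

/-! ### Approximation by grid values -/

/-- Truncation of `x` to `[0, N]`, rounded down to a multiple of `1 / N`. -/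
noncomputable def gridRound (N : ℕ) (x : ℝ) : ℝ :=
  (N : ℝ)⁻¹ * (⌊(N : ℝ) * min (max x 0) N⌋₊ : ℝ)

theorem gridRound_mono (N : ℕ) : Monotone (gridRound N) := by
  intro x y h
  unfold gridRound
  gcongr

theorem gridRound_nonneg (N : ℕ) (x : ℝ) : 0 ≤ gridRound N x := by
  unfold gridRound; positivity

theorem gridRound_le {N : ℕ} {x : ℝ} (hx : 0 ≤ x) : gridRound N x ≤ x := by
  unfold gridRound
  rcases Nat.eq_zero_or_pos N with rfl | hN
  · simpa using hx
  rw [inv_mul_le_iff₀ (by positivity)]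
  refine (Nat.floor_le (by positivity)).trans ?_
  gcongr
  exact (min_le_left _ _).trans (by simp [hx])

theorem exists_gridRound_eq (N : ℕ) (x : ℝ) :
    ∃ c : ℕ, c ≤ N * N ∧ gridRound N x = (N : ℝ)⁻¹ * c := by
  refine ⟨_, Nat.floor_le_of_le ?_, rfl⟩
  push_cast
  gcongr
  exact min_le_right _ _

theorem tendsto_gridRound {x : ℝ} (hx : 0 ≤ x) :
    Filter.Tendsto (fun N : ℕ => gridRound N x) Filter.atTop (nhds x) := by
  have h := (tendsto_nat_floor_mul_div_atTop hx).comp tendsto_natCast_atTop_atTop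
  refine h.congr' ?_
  filter_upwards [Filter.eventually_ge_atTop ⌈x⌉₊] with N hN
  have : x ≤ N := Nat.le_of_ceil_le hN
  simp only [Function.comp, gridRound, max_eq_left hx, min_eq_left this]
  rw [mul_comm x, div_eq_inv_mul]

/-- A convex function on the closed half-line may be discontinuous at `0`. Approach from below
within the half-line removes the problem: at `x = 0` the sequence is constant. -/
theorem ConvexOn.tendsto_map {f : ℝ → ℝ} (hf : ConvexOn ℝ (Set.Ici 0) f) {u : ℕ → ℝ} {x : ℝ}
    (hx : 0 ≤ x) (hu : Filter.Tendsto u Filter.atTop (nhds x)) (hu0 : ∀ N, 0 ≤ u N)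
    (hux : ∀ N, u N ≤ x) : Filter.Tendsto (fun N => f (u N)) Filter.atTop (nhds (f x)) := by
  rcases hx.eq_or_lt with rfl | hx
  · have : u = fun _ => 0 := funext fun N => le_antisymm (hux N) (hu0 N)
    simp [this]
  · have hc : ContinuousOn f (Set.Ioi 0) :=
      (hf.subset Set.Ioi_subset_Ici_self (convex_Ioi 0)).continuousOn isOpen_Ioi
    exact (hc.continuousAt (Ioi_mem_nhds hx)).tendsto.comp hu

theorem ConvexOn.measurable_comp_max {f : ℝ → ℝ} (hf : ConvexOn ℝ (Set.Ici 0) f) :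
    Measurable fun x => f (max x 0) := by
  have hc : ContinuousOn f (Set.Ioi 0) :=
    (hf.subset Set.Ioi_subset_Ici_self (convex_Ioi 0)).continuousOn isOpen_Ioi
  classical
  have h : (fun x => f (max x 0)) = (Set.Ioi 0).piecewise f fun _ => f 0 := by
    ext x
    by_cases hx : 0 < x
    · rw [Set.piecewise_eq_of_mem _ _ _ (show x ∈ Set.Ioi 0 from hx), max_eq_left hx.le]
    · rw [Set.piecewise_eq_of_notMem _ _ _ (show x ∉ Set.Ioi 0 from hx), max_eq_right (not_lt.1 hx)]
  rw [h]
  exact hc.measurable_piecewise continuousOn_const measurableSet_Ioi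

/-! ### The Poisson comparison for negatively associated sums -/

section

variable {Ω Ω' : Type*} [MeasurableSpace Ω] [MeasurableSpace Ω'] {μ : Measure Ω}
  [IsProbabilityMeasure μ] {ν : Measure Ω'} [IsProbabilityMeasure ν] {n : ℕ} {X : Fin n → Ω → ℝ}
  {Y : Fin n → Ω' → ℝ}

theorem NegativelyAssociated.lintegral_sum_gridRound_le (hX : NegativelyAssociated μ X)
    (hXY : ∀ i, IdentDistrib (X i) (Y i) μ ν) (hY : ∀ i, Measurable (Y i)) {f : ℝ → ℝ}
    (hf : ConvexOn ℝ (Set.Ici 0) f) (hfm : Measurable f) (hf0 : ∀ x, 0 ≤ f x) {N : ℕ}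
    (hN : 0 < N) :
    ∫⁻ ω, ENNReal.ofReal (f (∑ i, gridRound N (X i ω))) ∂μ ≤
      ∫⁻ k : ℕ, ∫⁻ ω, ENNReal.ofReal (f (k * ∑ i, gridRound N (Y i ω))) ∂ν ∂(poissonMeasure 1) := by
  have hr := (gridRound_mono N).measurable
  have hgY (i) : Measurable fun ω => gridRound N (Y i ω) := hr.comp (hY i)
  refine hf.le_lintegral_poisson_of_le_copies hfm hf0 hgY
    (fun i ω => gridRound_nonneg _ _) fun m σ hσ => ?_
  have hmp (i) := measurePreserving_eval (fun _ : Fin m => ν) (σ i)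
  have hZm (i) : Measurable fun ω : Fin m → Ω' => gridRound N (Y i (ω (σ i))) :=
    (hgY i).comp (measurable_pi_apply _)
  have hind : iIndepFun (fun i (ω : Fin m → Ω') => gridRound N (Y i (ω (σ i))))
      (Measure.pi fun _ => ν) := by
    -- Injectivity of `σ` means that distinct indices read distinct, hence independent, copies.
    have h := iIndepFun_pi (μ := fun _ : Fin m => ν) (X := fun _ ω => ω)
      (fun _ => aemeasurable_id)
    exact (h.precomp hσ).comp (fun i ω => gridRound N (Y i ω)) hgY
  have hid (i) : IdentDistrib (fun ω => gridRound N (X i ω))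
      (fun ω : Fin m → Ω' => gridRound N (Y i (ω (σ i)))) μ (Measure.pi fun _ => ν) := by
    have hY' : IdentDistrib (Y i) (fun ω : Fin m → Ω' => Y i (ω (σ i))) ν
        (Measure.pi fun _ : Fin m => ν) := by
      refine ⟨(hY i).aemeasurable, ((hY i).comp (hmp i).measurable).aemeasurable, ?_⟩
      conv_lhs => rw [← (hmp i).map_eq]
      exact Measure.map_map (hY i) (hmp i).measurable
    exact ((hXY i).trans hY').comp hr
  have hN' : (0 : ℝ) < (N : ℝ)⁻¹ := by positivity
  exact (hX.comp_monotone (gridRound_mono N)).lintegral_sum_le_of_iIndepFun hZm hind hid hN'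
    (fun i ω => exists_gridRound_eq N (X i ω)) Finset.univ hf hfm hf0

/-- Limit of the rounded estimate: Fatou on the `X` side, dominated convergence on the `Y` side,
with dominating function `f 0 + f (k * ∑ i, Y i)`. -/
theorem NegativelyAssociated.lintegral_sum_le_poisson (hX : NegativelyAssociated μ X)
    (hXY : ∀ i, IdentDistrib (X i) (Y i) μ ν) (hY : ∀ i, ∀ᵐ ω ∂ν, 0 ≤ Y i ω) {f : ℝ → ℝ}
    (hf : ConvexOn ℝ (Set.Ici 0) f) (hf0 : ∀ x, 0 ≤ x → 0 ≤ f x) :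
    ∫⁻ ω, ENNReal.ofReal (f (∑ i, X i ω)) ∂μ ≤
      ∫⁻ k : ℕ, ∫⁻ ω, ENNReal.ofReal (f (k * ∑ i, Y i ω)) ∂ν ∂(poissonMeasure 1) := by
  -- Values of `f` at negative arguments are unconstrained; they are replaced by `f 0`.
  wlog hf' : Measurable f ∧ ∀ x, 0 ≤ f x generalizing f
  · have hX0 : ∀ᵐ ω ∂μ, ∀ i, 0 ≤ X i ω :=
      ae_all_iff.2 fun i => (hXY i).symm.ae_snd measurableSet_Ici (hY i)
    have h := this (f := fun x => f (max x 0))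
      (hf.congr fun x hx => by simp only [max_eq_left (Set.mem_Ici.1 hx)])
      (fun x _ => hf0 _ (le_max_right _ _))
      ⟨hf.measurable_comp_max, fun x => hf0 _ (le_max_right _ _)⟩
    have e1 : ∫⁻ ω, ENNReal.ofReal (f (max (∑ i, X i ω) 0)) ∂μ =
        ∫⁻ ω, ENNReal.ofReal (f (∑ i, X i ω)) ∂μ := by
      refine lintegral_congr_ae ?_
      filter_upwards [hX0] with ω hω
      rw [max_eq_left (Finset.sum_nonneg fun i _ => hω i)]
    have e2 (k : ℕ) : ∫⁻ ω, ENNReal.ofReal (f (max (k * ∑ i, Y i ω) 0)) ∂ν =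
        ∫⁻ ω, ENNReal.ofReal (f (k * ∑ i, Y i ω)) ∂ν := by
      refine lintegral_congr_ae ?_
      filter_upwards [ae_all_iff.2 hY] with ω hω
      rw [max_eq_left (mul_nonneg (Nat.cast_nonneg _) (Finset.sum_nonneg fun i _ => hω i))]
    simpa only [e1, e2] using h
  obtain ⟨hfm, hf0⟩ := hf'
  wlog hY' : ∀ i, Measurable (Y i) generalizing Y
  · have hYm (i) : AEMeasurable (Y i) ν := (hXY i).aemeasurable_snd
    have h := this (Y := fun i => (hYm i).mk (Y i))
      (fun i => (hXY i).trans (IdentDistrib.of_ae_eq (hYm i) (hYm i).ae_eq_mk))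
      (fun i => by filter_upwards [hY i, (hYm i).ae_eq_mk] with ω h1 h2; rwa [← h2])
      (fun i => (hYm i).measurable_mk)
    refine h.trans (le_of_eq (lintegral_congr fun k => lintegral_congr_ae ?_))
    filter_upwards [ae_all_iff.2 fun i => (hYm i).ae_eq_mk] with ω hω
    simp only [hω]
  have hX0 : ∀ᵐ ω ∂μ, ∀ i, 0 ≤ X i ω :=
    ae_all_iff.2 fun i => (hXY i).symm.ae_snd measurableSet_Ici (hY i)
  have hXm (i) : AEMeasurable (X i) μ := (hXY i).aemeasurable_fst
  have hr (N) := (gridRound_mono N).measurable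
  -- Finiteness of the right side is what makes the dominating function integrable.
  by_cases htop : ∫⁻ k : ℕ, ∫⁻ ω, ENNReal.ofReal (f (k * ∑ i, Y i ω)) ∂ν ∂(poissonMeasure 1) = ⊤
  · rw [htop]; exact le_top
  have hprod (W : Fin n → Ω' → ℝ) (hW : ∀ i, Measurable (W i)) :
      ∫⁻ k : ℕ, ∫⁻ ω, ENNReal.ofReal (f (k * ∑ i, W i ω)) ∂ν ∂(poissonMeasure 1) =
        ∫⁻ z, ENNReal.ofReal (f (z.1 * ∑ i, W i z.2)) ∂((poissonMeasure 1).prod ν) := by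
    rw [lintegral_prod]
    have : Measurable fun k : ℕ => (k : ℝ) := measurable_from_top
    have h2 : Measurable fun z : ℕ × Ω' => ((z.1 : ℕ) : ℝ) := this.comp measurable_fst
    fun_prop
  have hY0 : ∀ᵐ z ∂((poissonMeasure 1).prod ν), ∀ i, 0 ≤ Y i z.2 :=
    Measure.quasiMeasurePreserving_snd.ae (ae_all_iff.2 hY)
  have hlim : Filter.Tendsto (fun N : ℕ => ∫⁻ z : ℕ × Ω',
      ENNReal.ofReal (f (z.1 * ∑ i, gridRound N (Y i z.2))) ∂((poissonMeasure 1).prod ν))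
      Filter.atTop (nhds (∫⁻ z : ℕ × Ω', ENNReal.ofReal (f (z.1 * ∑ i, Y i z.2))
        ∂((poissonMeasure 1).prod ν))) := by
    have hk : Measurable fun k : ℕ => (k : ℝ) := measurable_from_top
    have hk2 : Measurable fun z : ℕ × Ω' => ((z.1 : ℕ) : ℝ) := hk.comp measurable_fst
    refine tendsto_lintegral_of_dominated_convergence
      (fun z => ENNReal.ofReal (f 0) + ENNReal.ofReal (f (z.1 * ∑ i, Y i z.2)))
      (fun N => by fun_prop) (fun N => ?_) ?_ ?_
    · filter_upwards [hY0] with z hz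
      rw [← ENNReal.ofReal_add (hf0 _) (hf0 _)]
      refine ENNReal.ofReal_le_ofReal (hf.map_le_add_of_nonneg hf0 ?_ ?_)
      · exact mul_nonneg (Nat.cast_nonneg _) (Finset.sum_nonneg fun i _ => gridRound_nonneg _ _)
      · gcongr with i
        exact gridRound_le (hz i)
    · rw [lintegral_add_left measurable_const, ← hprod Y hY']
      simpa using htop
    · filter_upwards [hY0] with z hz
      refine ENNReal.tendsto_ofReal (hf.tendsto_map ?_ ?_ (fun N => ?_) fun N => ?_)
      · exact mul_nonneg (Nat.cast_nonneg _) (Finset.sum_nonneg fun i _ => hz i)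
      · exact (tendsto_finsetSum _ fun i _ => tendsto_gridRound (hz i)).const_mul _
      · exact mul_nonneg (Nat.cast_nonneg _) (Finset.sum_nonneg fun i _ => gridRound_nonneg _ _)
      · gcongr with i
        exact gridRound_le (hz i)
  calc ∫⁻ ω, ENNReal.ofReal (f (∑ i, X i ω)) ∂μ
      = ∫⁻ ω, Filter.liminf (fun N : ℕ => ENNReal.ofReal (f (∑ i, gridRound N (X i ω))))
          Filter.atTop ∂μ := by
        refine lintegral_congr_ae ?_
        filter_upwards [hX0] with ω hω
        refine (ENNReal.tendsto_ofReal (hf.tendsto_map ?_ ?_ (fun N => ?_) fun N => ?_)).liminf_eq.symm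
        · exact Finset.sum_nonneg fun i _ => hω i
        · exact tendsto_finsetSum _ fun i _ => tendsto_gridRound (hω i)
        · exact Finset.sum_nonneg fun i _ => gridRound_nonneg _ _
        · gcongr with i
          exact gridRound_le (hω i)
    _ ≤ Filter.liminf (fun N : ℕ => ∫⁻ ω, ENNReal.ofReal (f (∑ i, gridRound N (X i ω))) ∂μ)
          Filter.atTop := by
        refine lintegral_liminf_le' fun N => ?_
        have h (i : Fin n) : AEMeasurable (fun ω => gridRound N (X i ω)) μ :=
          (hr N).comp_aemeasurable (hXm i)
        fun_prop
    _ ≤ Filter.liminf (fun N : ℕ => ∫⁻ z : ℕ × Ω',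
          ENNReal.ofReal (f (z.1 * ∑ i, gridRound N (Y i z.2))) ∂((poissonMeasure 1).prod ν))
          Filter.atTop := by
        refine Filter.liminf_le_liminf ?_
        filter_upwards [Filter.eventually_gt_atTop 0] with N hN
        rw [← hprod (fun i ω => gridRound N (Y i ω)) fun i => (hr N).comp (hY' i)]
        exact hX.lintegral_sum_gridRound_le hXY hY' hf hfm hf0 hN
    _ = ∫⁻ k : ℕ, ∫⁻ ω, ENNReal.ofReal (f (k * ∑ i, Y i ω)) ∂ν ∂(poissonMeasure 1) := by
        rw [hlim.liminf_eq, hprod Y hY']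

end

/-! ### Product laws and extended expectations -/

theorem lintegral_mul_of_indepFun_poisson {Ω' : Type*} [MeasurableSpace Ω'] {ν : Measure Ω'}
    [IsProbabilityMeasure ν] {P S : Ω' → ℝ}
    (hP : HasLaw P ((poissonMeasure 1).map (fun k : ℕ => (k : ℝ))) ν) (hS : AEMeasurable S ν)
    (hPS : IndepFun P S ν) {h : ℝ → ℝ≥0∞} (hh : Measurable h) :
    ∫⁻ ω, h (P ω * S ω) ∂ν = ∫⁻ k : ℕ, ∫⁻ ω, h (k * S ω) ∂ν ∂(poissonMeasure 1) := by
  have hm : Measurable fun z : ℝ × ℝ => h (z.1 * z.2) := by fun_prop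
  rw [← lintegral_map' (f := fun z : ℝ × ℝ => h (z.1 * z.2)) hm.aemeasurable
      (hP.aemeasurable.prodMk hS),
    (indepFun_iff_map_prod_eq_prod_map_map hP.aemeasurable hS).1 hPS, hP.map_eq,
    lintegral_prod _ hm.aemeasurable, lintegral_map hm.lintegral_prod_right' measurable_from_top]
  refine lintegral_congr fun k => ?_
  rw [lintegral_map' (Measurable.aemeasurable (by fun_prop)) hS]

theorem lintegral_nat_lintegral_swap {Ω' : Type*} [MeasurableSpace Ω'] {ν : Measure Ω'}
    {ρ : Measure ℕ} {F : ℕ → Ω' → ℝ≥0∞} (hF : ∀ k, AEMeasurable (F k) ν) :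
    ∫⁻ k, ∫⁻ ω, F k ω ∂ν ∂ρ = ∫⁻ ω, ∫⁻ k, F k ω ∂ρ ∂ν := by
  simp only [lintegral_countable']
  rw [lintegral_tsum fun k => (hF k).mul_const _]
  exact tsum_congr fun k => (lintegral_mul_const'' _ (hF k)).symm

/-- A subtraction-free form of the splitting into positive part and truncated negative part, so that
it can be integrated in `[0, ∞]`. -/
theorem ofReal_max_neg_add (x : ℝ) (K : ℕ) :
    ENNReal.ofReal (max x (-K) + K) + min (ENNReal.ofReal (-x)) K = ENNReal.ofReal x + K := by
  have hK : (0 : ℝ) ≤ K := Nat.cast_nonneg K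
  rw [← ENNReal.ofReal_natCast K]
  rcases le_total 0 x with h | h
  · rw [max_eq_left (by linarith), ENNReal.ofReal_of_nonpos (by linarith : -x ≤ 0),
      ENNReal.ofReal_add h hK]
    simp
  · rw [ENNReal.ofReal_of_nonpos h, zero_add]
    rcases le_total x (-K) with h2 | h2
    · rw [max_eq_right h2, min_eq_right (ENNReal.ofReal_le_ofReal (by linarith))]
      simp
    · rw [max_eq_left h2, min_eq_left (ENNReal.ofReal_le_ofReal (by linarith)),
        ← ENNReal.ofReal_add (by linarith) (by linarith)]
      congr 1; ring

theorem EReal.coe_sub_le_coe_sub {a b c d : ℝ≥0∞} (h : a + d ≤ c + b) (hab : a ≠ ⊤ ∨ b ≠ ⊤)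
    (hcd : c ≠ ⊤ ∨ d ≠ ⊤) : (a : EReal) - b ≤ (c : EReal) - d := by
  by_cases hb : b = ⊤
  · simp [hb]
  by_cases hc : c = ⊤
  · have hd := hcd.resolve_left (not_not.2 hc)
    lift d to NNReal using hd
    simp only [hc, EReal.coe_ennreal_top]
    rw [EReal.top_sub (by simp)]
    exact le_top
  have had := h.trans_lt (ENNReal.add_lt_top.2 ⟨lt_top_iff_ne_top.2 hc, lt_top_iff_ne_top.2 hb⟩)
  obtain ⟨ha, hd⟩ := ENNReal.add_lt_top.1 had
  lift a to NNReal using ha.ne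
  lift b to NNReal using hb
  lift c to NNReal using hc
  lift d to NNReal using hd.ne
  norm_cast at h
  have h' : (a : ℝ) + d ≤ c + b := by exact_mod_cast h
  have e (x : NNReal) : ((x : ℝ≥0∞) : EReal) = ((x : ℝ) : EReal) := rfl
  simp only [e, ← EReal.coe_sub, EReal.coe_le_coe_iff]
  linarith

/-- Each truncation yields `E U⁺ + E min(V⁻, K) ≤ E V⁺ + E U⁻` after cancelling the finite `K`;
monotone convergence in `K` then restores `E V⁻`. -/
theorem expectation_le_of_truncations {Ω Ω' : Type*} [MeasurableSpace Ω] [MeasurableSpace Ω']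
    {μ : Measure Ω} [IsProbabilityMeasure μ] {ν : Measure Ω'} [IsProbabilityMeasure ν]
    {U : Ω → ℝ} {V : Ω' → ℝ} (hU : ExpectationExists μ U) (hV : ExpectationExists ν V)
    (h : ∀ K : ℕ, ∫⁻ ω, ENNReal.ofReal (max (U ω) (-K) + K) ∂μ ≤
      ∫⁻ ω, ENNReal.ofReal (max (V ω) (-K) + K) ∂ν) : expectation μ U ≤ expectation ν V := by
  obtain ⟨hUm, hU⟩ := hU
  obtain ⟨hVm, hV⟩ := hV
  refine EReal.coe_sub_le_coe_sub ?_ hU hV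
  have hK (K : ℕ) : ∫⁻ ω, ENNReal.ofReal (U ω) ∂μ + ∫⁻ ω, min (ENNReal.ofReal (-V ω)) K ∂ν ≤
      ∫⁻ ω, ENNReal.ofReal (V ω) ∂ν + ∫⁻ ω, ENNReal.ofReal (-U ω) ∂μ := by
    have eU : ∫⁻ ω, ENNReal.ofReal (max (U ω) (-K) + K) ∂μ + ∫⁻ ω, min (ENNReal.ofReal (-U ω)) K ∂μ =
        ∫⁻ ω, ENNReal.ofReal (U ω) ∂μ + K := by
      rw [← lintegral_add_left' (by fun_prop)]
      simp only [ofReal_max_neg_add]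
      rw [lintegral_add_left' (by fun_prop)]
      simp
    have eV : ∫⁻ ω, ENNReal.ofReal (max (V ω) (-K) + K) ∂ν + ∫⁻ ω, min (ENNReal.ofReal (-V ω)) K ∂ν =
        ∫⁻ ω, ENNReal.ofReal (V ω) ∂ν + K := by
      rw [← lintegral_add_left' (by fun_prop)]
      simp only [ofReal_max_neg_add]
      rw [lintegral_add_left' (by fun_prop)]
      simp
    have hmin : ∫⁻ ω, min (ENNReal.ofReal (-U ω)) K ∂μ ≤ ∫⁻ ω, ENNReal.ofReal (-U ω) ∂μ :=
      lintegral_mono fun ω => min_le_left _ _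
    refine le_trans ?_ (add_le_add_right hmin _)
    refine (ENNReal.add_le_add_iff_right (ENNReal.natCast_ne_top K)).1 ?_
    rw [add_right_comm, ← eU, add_right_comm _ _ (K : ℝ≥0∞), ← eV, add_right_comm]
    gcongr ?_ + _ + _
    · exact h K
  have hsup : ∫⁻ ω, ENNReal.ofReal (-V ω) ∂ν = ⨆ K : ℕ, ∫⁻ ω, min (ENNReal.ofReal (-V ω)) K ∂ν := by
    rw [← lintegral_iSup' (f := fun (K : ℕ) ω => min (ENNReal.ofReal (-V ω)) K)
      (fun K => by fun_prop)
      (.of_forall fun ω K L hKL => min_le_min_left _ (by exact_mod_cast hKL))]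
    refine lintegral_congr fun ω => le_antisymm ?_ (iSup_le fun K => min_le_left _ _)
    obtain ⟨K, hK⟩ := ENNReal.exists_nat_gt (ENNReal.ofReal_ne_top (r := -V ω))
    exact le_iSup_of_le K (by rw [min_eq_left hK.le])
  rw [hsup, ENNReal.add_iSup]
  exact iSup_le hK

/-! ### The constant `A(f)` -/

theorem ConvexOn.ofReal_le_lintegral_poisson {f : ℝ → ℝ} (hf : ConvexOn ℝ (Set.Ici 0) f)
    (hf0 : ∀ x, 0 ≤ x → 0 ≤ f x) {t : ℝ} (ht : 0 ≤ t) :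
    ENNReal.ofReal (f t) ≤ ∫⁻ k : ℕ, ENNReal.ofReal (f (t * k)) ∂(poissonMeasure 1) := by
  -- The case of a single deterministic summand `t`.
  have h := ConvexOn.le_lintegral_poisson_of_le_copies (ν := Measure.dirac ())
    (f := fun x => f (max x 0))
    (hf.congr fun x hx => by simp only [max_eq_left (Set.mem_Ici.1 hx)])
    hf.measurable_comp_max (fun x => hf0 _ (le_max_right _ _)) (n := 1) (Y := fun _ _ => t)
    (fun _ => measurable_const) (fun _ _ => ht) (a := ENNReal.ofReal (f t))
    (fun m σ _ => by simp [ht])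
  refine h.trans (le_of_eq (lintegral_congr fun k => ?_))
  simp only [Finset.univ_unique, Finset.sum_const, Finset.card_singleton, one_smul,
    lintegral_const, measure_univ, mul_one]
  rw [max_eq_left (by positivity), mul_comm]

theorem lintegral_poisson_le_poissonRatio_mul {f : ℝ → ℝ} (hA : poissonRatio f ≠ ⊤) {t : ℝ}
    (ht : 0 < t) : ∫⁻ k : ℕ, ENNReal.ofReal (f (t * k)) ∂(poissonMeasure 1) ≤
      poissonRatio f * ENNReal.ofReal (f t) := by
  have hle : ∫⁻ k : ℕ, ENNReal.ofReal (f (t * k)) / ENNReal.ofReal (f t) ∂(poissonMeasure 1) ≤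
      poissonRatio f := le_iSup₂_of_le t ht le_rfl
  have hm (g : ℕ → ℝ≥0∞) : Measurable g := measurable_from_top
  by_cases h0 : ENNReal.ofReal (f t) = 0
  -- With `f t = 0`, a finite ratio forces `f (t * k) = 0` almost surely, because `c / 0 = ∞` for `c
  -- > 0`.
  · have hae := ae_lt_top (hm _) (hle.trans_lt (lt_top_iff_ne_top.2 hA)).ne
    rw [h0, mul_zero, nonpos_iff_eq_zero, lintegral_eq_zero_iff (hm _)]
    filter_upwards [hae] with k hk
    by_contra hne
    rw [h0, ENNReal.div_zero hne] at hk
    exact lt_irrefl _ hk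
  · calc _ = ∫⁻ k : ℕ, ENNReal.ofReal (f (t * k)) / ENNReal.ofReal (f t) * ENNReal.ofReal (f t)
          ∂(poissonMeasure 1) :=
          lintegral_congr fun k => (ENNReal.div_mul_cancel h0 ENNReal.ofReal_ne_top).symm
      _ ≤ _ := by
          rw [lintegral_mul_const _ (hm _)]
          gcongr

/-- Needed where the sum vanishes, since the supremum only ranges over `t > 0`. If `f 1 ≠ 0`,
compare `f 1 ≤ E f(P) ≤ A(f) * f 1`; if `f 1 = 0` and `A(f)` is finite, then `E f(P) = 0`, and the
atom of `P` at `0` contradicts `f 0 ≠ 0`. -/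
theorem ConvexOn.one_le_poissonRatio {f : ℝ → ℝ} (hf : ConvexOn ℝ (Set.Ici 0) f)
    (hf0 : ∀ x, 0 ≤ x → 0 ≤ f x) (h0 : f 0 ≠ 0) : 1 ≤ poissonRatio f := by
  by_cases hA : poissonRatio f = ⊤
  · simp [hA]
  have hle := lintegral_poisson_le_poissonRatio_mul hA one_pos
  have hJ := hf.ofReal_le_lintegral_poisson hf0 zero_le_one
  by_cases h1 : ENNReal.ofReal (f 1) = 0
  · rw [h1, mul_zero, nonpos_iff_eq_zero, lintegral_countable', ENNReal.tsum_eq_zero] at hle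
    have := hle 0
    rw [poissonMeasure_singleton] at this
    simp only [mul_eq_zero, ENNReal.ofReal_eq_zero] at this
    rcases this with h | h
    · refine absurd (le_antisymm ?_ (hf0 0 le_rfl)) h0
      simpa using h
    · exact absurd h (not_le.2 (by positivity))
  · have := hJ.trans hle
    rw [← ENNReal.div_le_iff h1 ENNReal.ofReal_ne_top,
      ENNReal.div_self h1 ENNReal.ofReal_ne_top] at this
    exact this

theorem ConvexOn.lintegral_poisson_le_poissonRatio_mul_of_nonneg {f : ℝ → ℝ}
    (hf : ConvexOn ℝ (Set.Ici 0) f) (hf0 : ∀ x, 0 ≤ x → 0 ≤ f x) (hA : poissonRatio f ≠ ⊤) {t : ℝ}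
    (ht : 0 ≤ t) : ∫⁻ k : ℕ, ENNReal.ofReal (f (k * t)) ∂(poissonMeasure 1) ≤
      poissonRatio f * ENNReal.ofReal (f t) := by
  rcases ht.eq_or_lt with rfl | ht
  · simp only [mul_zero, lintegral_const, measure_univ, mul_one]
    by_cases h0 : f 0 = 0
    · simp [h0]
    · exact le_mul_of_one_le_left zero_le (hf.one_le_poissonRatio hf0 h0)
  · simpa only [mul_comm] using lintegral_poisson_le_poissonRatio_mul hA ht

/-! ### Poisson moments and norms -/

theorem integrable_rpow_poissonMeasure (q : ℝ) :
    Integrable (fun k : ℕ => (k : ℝ) ^ q) (poissonMeasure 1) := by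
  rw [integrable_poissonMeasure_iff]
  set N := ⌈q⌉₊
  have hs : Summable fun k : ℕ => (N.factorial : ℝ) * (Real.exp 1 ^ k / k.factorial) :=
    (Real.summable_pow_div_factorial _).mul_left _
  refine Summable.of_norm_bounded_eventually_nat hs ?_
  filter_upwards [Filter.eventually_ge_atTop 1] with k hk
  have hk1 : (1 : ℝ) ≤ k := by exact_mod_cast hk
  have h1 : (k : ℝ) ^ q ≤ N.factorial * Real.exp 1 ^ k := by
    calc (k : ℝ) ^ q ≤ (k : ℝ) ^ (N : ℝ) :=
          Real.rpow_le_rpow_of_exponent_le hk1 (Nat.le_ceil q)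
      _ = (k : ℝ) ^ N := Real.rpow_natCast _ _
      _ ≤ N.factorial * Real.exp k := by
          have := Real.pow_div_factorial_le_exp (k : ℝ) (by positivity) N
          rwa [div_le_iff₀ (by positivity), mul_comm] at this
      _ = _ := by rw [← Real.exp_nat_mul, mul_one]
  have h2 : Real.exp (-(1 : NNReal)) ≤ 1 := by simp
  have h3 : (0 : ℝ) ≤ (k : ℝ) ^ q := by positivity
  rw [norm_mul, norm_norm, Real.norm_of_nonneg h3, Real.norm_of_nonneg (by positivity)]
  calc Real.exp (-(1 : NNReal)) * ((1 : NNReal) : ℝ) ^ k / k.factorial * (k : ℝ) ^ q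
      ≤ 1 * ((1 : NNReal) : ℝ) ^ k / k.factorial * (N.factorial * Real.exp 1 ^ k) := by gcongr
    _ = _ := by simp; ring

theorem eLpNorm_ofReal_eq_of_nonneg {Ω : Type*} [MeasurableSpace Ω] {μ : Measure Ω} {U : Ω → ℝ}
    (hU : ∀ᵐ ω ∂μ, 0 ≤ U ω) {q : ℝ} (hq : 0 < q) :
    eLpNorm U (ENNReal.ofReal q) μ = (∫⁻ ω, ENNReal.ofReal (U ω ^ q) ∂μ) ^ (1 / q) := by
  rw [eLpNorm_eq_lintegral_rpow_enorm_toReal (by simpa using hq) ENNReal.ofReal_ne_top,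
    ENNReal.toReal_ofReal hq.le]
  congr 1
  refine lintegral_congr_ae ?_
  filter_upwards [hU] with ω hω
  rw [Real.enorm_eq_ofReal hω, ENNReal.ofReal_rpow_of_nonneg hω hq.le]

/-! ### The three comparisons -/

theorem mainTheorem5 {Ω Ω' : Type*} [MeasurableSpace Ω] [MeasurableSpace Ω']
    (μ : Measure Ω) [IsProbabilityMeasure μ] (ν : Measure Ω') [IsProbabilityMeasure ν]
    (n : ℕ) (X : Fin n → Ω → ℝ) (Y : Fin n → Ω' → ℝ)
    (hY : ∀ i, ∀ᵐ ω ∂ν, 0 ≤ Y i ω)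
    (hX : NegativelyAssociated μ X)
    (hXY : ∀ i, IdentDistrib (X i) (Y i) μ ν) :
    (∀ P : Ω' → ℝ,
      HasLaw P ((poissonMeasure 1).map (fun k : ℕ => (k : ℝ))) ν →
      IndepFun P (fun ω i => Y i ω) ν →
        ConvexOrderLE μ (fun ω => ∑ i, X i ω) ν (fun ω => P ω * ∑ i, Y i ω)) ∧
    (∀ f : ℝ → ℝ, ConvexOn ℝ (Set.Ici 0) f → (∀ x, 0 ≤ x → 0 ≤ f x) →
      -- the product on the right is not the indeterminate form `∞ * 0`
      ¬ (poissonRatio f = ⊤ ∧ ∫⁻ ω, ENNReal.ofReal (f (∑ i, Y i ω)) ∂ν = 0) →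
        ∫⁻ ω, ENNReal.ofReal (f (∑ i, X i ω)) ∂μ
          ≤ poissonRatio f * ∫⁻ ω, ENNReal.ofReal (f (∑ i, Y i ω)) ∂ν) ∧
    (∀ q : ℝ, 1 ≤ q →
      eLpNorm (fun ω => ∑ i, X i ω) (ENNReal.ofReal q) μ
        ≤ ENNReal.ofReal (fractionalBell q ^ (1 / q))
          * eLpNorm (fun ω => ∑ i, Y i ω) (ENNReal.ofReal q) ν) := by
  have hYm (i : Fin n) : AEMeasurable (Y i) ν := (hXY i).aemeasurable_snd
  have hSm : AEMeasurable (fun ω => ∑ i, Y i ω) ν :=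
    Finset.aemeasurable_fun_sum _ fun i _ => hYm i
  have hS0 : ∀ᵐ ω ∂ν, 0 ≤ ∑ i, Y i ω := by
    filter_upwards [ae_all_iff.2 hY] with ω hω
    exact Finset.sum_nonneg fun i _ => hω i
  have hX0 : ∀ᵐ ω ∂μ, 0 ≤ ∑ i, X i ω := by
    filter_upwards [ae_all_iff.2 fun i => (hXY i).symm.ae_snd measurableSet_Ici (hY i)] with ω hω
    exact Finset.sum_nonneg fun i _ => hω i
  refine ⟨fun P hP hPY φ hφ hU hV => ?_, fun f hf hf0 hind => ?_, fun q hq => ?_⟩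
  · refine expectation_le_of_truncations hU hV fun K => ?_
    have hφm : Measurable φ := 
      (continuousOn_univ.1 (hφ.continuousOn isOpen_univ)).measurable
    have hPS : IndepFun P (fun ω => ∑ i, Y i ω) ν :=
      hPY.comp measurable_id (ψ := fun y : Fin n → ℝ => ∑ i, y i) (by fun_prop)
    rw [lintegral_mul_of_indepFun_poisson hP hSm hPS
      (h := fun x => ENNReal.ofReal (max (φ x) (-K) + K)) (by fun_prop)]
    refine hX.lintegral_sum_le_poisson hXY hY (f := fun x => max (φ x) (-K) + K) ?_ fun x _ => ?_
    · exact (((hφ.sup (convexOn_const _ convex_univ)).add_const _).subset (Set.subset_univ _)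
        (convex_Ici 0))
    · linarith [le_max_right (φ x) (-K)]
  · by_cases hA : poissonRatio f = ⊤
    · rw [hA, ENNReal.top_mul fun h => hind ⟨hA, h⟩]
      exact le_top
    refine (hX.lintegral_sum_le_poisson hXY hY hf hf0).trans ?_
    have hfS (k : ℕ) : AEMeasurable (fun ω => ENNReal.ofReal (f (k * ∑ i, Y i ω))) ν := by
      have h1 : AEMeasurable (fun ω => ENNReal.ofReal (f (max (k * ∑ i, Y i ω) 0))) ν :=
        (hf.measurable_comp_max.comp_aemeasurable (hSm.const_mul (k : ℝ))).ennreal_ofReal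
      refine h1.congr ?_
      filter_upwards [hS0] with ω hω
      rw [max_eq_left (by positivity)]
    -- Integrating over the Poisson variable first reduces the claim to a pointwise one in `ω`; `hfS
    -- 1` supplies the measurability of `f` of the sum.
    rw [lintegral_nat_lintegral_swap hfS, ← lintegral_const_mul'' _ (by simpa using hfS 1)]
    refine lintegral_mono_ae ?_
    filter_upwards [hS0] with ω hω
    exact hf.lintegral_poisson_le_poissonRatio_mul_of_nonneg hf0 hA hω
  · have hq0 : 0 < q := by linarith
    have h := hX.lintegral_sum_le_poisson hXY hY (convexOn_rpow hq)
      fun x hx => Real.rpow_nonneg hx q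
    have hk (k : ℕ) : ∫⁻ ω, ENNReal.ofReal ((k * ∑ i, Y i ω) ^ q) ∂ν =
        ENNReal.ofReal ((k : ℝ) ^ q) * ∫⁻ ω, ENNReal.ofReal ((∑ i, Y i ω) ^ q) ∂ν := by
      rw [← lintegral_const_mul'' _ (by fun_prop)]
      refine lintegral_congr_ae ?_
      filter_upwards [hS0] with ω hω
      rw [Real.mul_rpow (by positivity) hω, ENNReal.ofReal_mul (by positivity)]
    simp only [hk] at h
    rw [lintegral_mul_const _ measurable_from_top, ← ofReal_integral_eq_lintegral_ofReal
      (integrable_rpow_poissonMeasure q) (.of_forall fun k => by positivity)] at h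
    have hB : 0 ≤ fractionalBell q := integral_nonneg fun k => by positivity
    rw [eLpNorm_ofReal_eq_of_nonneg hX0 hq0, eLpNorm_ofReal_eq_of_nonneg hS0 hq0,
      ← ENNReal.ofReal_rpow_of_nonneg hB (by positivity),
      ← ENNReal.mul_rpow_of_nonneg _ _ (by positivity)]
    exact ENNReal.rpow_le_rpow h (by positivity)
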